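/- Fix countably infinite sets $\mathrm{Att}$, $\mathrm{Const}$, $\mathrm{Rel}$ of attributes, constants and relation names, each relation name $R$ coming with a finite set $\mathrm{Att}(R)\subseteq\mathrm{Att}$. Let $\mathbb{K}=(K,\oplus,0)$ be a non-trivial commutative monoid that is positive ($a\oplus b=0$ implies $a=b=0$) and weakly cancellative ($a\oplus b=b$ implies $a=0$), and write $a\le b$ if $a\oplus c=b$ for some $c\in K$. A $\mathbb{K}$-database $\mathfrak{D}$ over a finite set $\mathbf{S}\subseteq\mathrm{Rel}$ (a schema) assigns to each $R\in\mathbf{S}$ a finitely supported function $R^{\mathfrak{D}}$ from the tuples $t\colon\mathrm{Att}(R)\to\mathrm{Const}$ to $K$. For pairwise distinct $A_1,\dots,A_n\in\mathrm{Att}(R)$ and $\vec a\in\mathrm{Const}^n$ put $R^{\mathfrak{D}}[A_1,\dots,A_n](\vec a)=\bigoplus\{R^{\mathfrak{D}}(t) : t(A_i)=a_i \text{ for all } i\}$ (sum over tuples $t$). An inclusion dependency (IND) is an expression $R[A_1,\dots,A_n]\le S[B_1,\dots,B_n]$ with $n\ge 0$, $A_1,\dots,A_n\in\mathrm{Att}(R)$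 pairwise distinct and $B_1,\dots,B_n\in\mathrm{Att}(S)$ pairwise distinct; $\mathfrak{D}$ satisfies it if $R^{\mathfrak{D}}[A_1,\dots,A_n](\vec a)\le S^{\mathfrak{D}}[B_1,\dots,B_n](\vec a)$ for all $\vec a\in\mathrm{Const}^n$. For a finite set $\Sigma\cup\{\tau\}$ of INDs, $\Sigma\models_{\mathbb{K}}\tau$ means that every $\mathbb{K}$-database, over any schema containing the relation names occurring in $\Sigma\cup\{\tau\}$, that satisfies every member of $\Sigma$ satisfies $\tau$. Write $\Sigma\vdash_{\mathrm{ws}}\tau$ if $\tau$ is derivable from $\Sigma$ by the rules - reflexivity: $R[A_1,\dots,A_n]\le R[A_1,\dots,A_n]$ for pairwise distinct $A_1,\dots,A_n\in\mathrm{Att}(R)$; - transitivity: from $R[\vec A]\le S[\vec B]$ and $S[\vec B]\le T[\vec C]$ infer $R[\vec A]\le T[\vec C]$; - projection and permutation: from $R[A_1,\dots,A_n]\le S[B_1,\dots,B_n]$ infer $R[A_{i_1},\dots,A_{i_\ell}]\le S[B_{i_1},\dots,B_{i_\ell}]$ for distinct $i_1,\dots,i_\ell\in\{1,\dots,n\}$;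 - weak symmetry: from $R[\vec A]\le S[\vec B]$ and $S[\emptyset]\le R[\emptyset]$ infer $S[\vec B]\le R[\vec A]$, where $\emptyset$ is the empty sequence of attributes. Then these rules are sound and complete for entailment over $\mathbb{K}$-databases: for every finite set $\Sigma\cup\{\tau\}$ of INDs, $\Sigma\vdash_{\mathrm{ws}}\tau$ implies $\Sigma\models_{\mathbb{K}}\tau$ (soundness), and $\Sigma\models_{\mathbb{K}}\tau$ implies $\Sigma\vdash_{\mathrm{ws}}\tau$ (completeness). -/

import Mathlib

namespace KDep

/-- The natural (pre)order of a commutative monoid, written additively: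
`a ≤ b` iff `a + c = b` for some `c`. -/
def NatLE {K : Type*} [AddCommMonoid K] (a b : K) : Prop :=
  ∃ c : K, a + c = b

/-- A monoid is positive if `a + b = 0` entails `a = 0` and `b = 0`. -/
def IsPositive (K : Type*) [AddCommMonoid K] : Prop :=
  ∀ a b : K, a + b = 0 → a = 0 ∧ b = 0

/-- A monoid is weakly cancellative if `a + b = b` entails `a = 0`. -/
def IsWeaklyCancellative (K : Type*) [AddCommMonoid K] : Prop :=
  ∀ a b : K, a + b = b → a = 0

/-- Tuples over a finite set `X` of attributes: functions from `X` to the constants. -/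
abbrev Tup {Att : Type*} (Const : Type*) (X : Finset Att) : Type _ :=
  {A : Att // A ∈ X} → Const

/-- `K`-relations over `X`: finitely supported functions from the tuples over `X` to `K`. -/
abbrev KRelation {Att : Type*} (Const K : Type*) [AddCommMonoid K] (X : Finset Att) : Type _ :=
  Tup Const X →₀ K

open Classical in
/-- The marginal weight `r[A₁,…,Aₙ](a₁,…,aₙ)`: the sum of `r t` over all tuples `t` with
`t(Aᵢ) = aᵢ` for every `i`. The sum is taken over the (finite) support of `r`; all other tuples
contribute `0`. -/
noncomputable def KRelation.marg {Att Const K : Type*} [AddCommMonoid K] {X : Finset Att}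
    (r : KRelation Const K X) {n : ℕ} (A : Fin n ↪ {A : Att // A ∈ X}) (a : Fin n → Const) : K :=
  ∑ t ∈ r.support with (∀ i : Fin n, t (A i) = a i), r t

/-- An inclusion dependency `lhs[A₁,…,Aₙ] ≤ rhs[B₁,…,Bₙ]`, where `att R` is the set of attributes
of the relation name `R`. The two sequences of pairwise distinct attributes (of `lhs` and `rhs`
respectively) are injective maps from `Fin arity`. The arity may be `0`. -/
structure IND {Att Rel : Type*} (att : Rel → Finset Att) where
  lhs : Rel
  rhs : Rel
  arity : ℕ
  lattrs : Fin arity ↪ {A : Att // A ∈ att lhs}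
  rattrs : Fin arity ↪ {B : Att // B ∈ att rhs}

/-- The inclusion dependency speaks only of relation names of the schema `S`. -/
def IND.Over {Att Rel : Type*} {att : Rel → Finset Att} (σ : IND att) (S : Finset Rel) : Prop :=
  σ.lhs ∈ S ∧ σ.rhs ∈ S

/-- A `K`-database over the schema `S` (a finite set of relation names): one `K`-relation over
`att R` for each `R ∈ S`. -/
abbrev KDatabase {Att Rel : Type*} (att : Rel → Finset Att) (Const K : Type*) [AddCommMonoid K]
    (S : Finset Rel) : Type _ :=
  ∀ R : {R : Rel // R ∈ S}, KRelation Const K (att R.1)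

/-- `D` satisfies `R[A₁,…,Aₙ] ≤ S[B₁,…,Bₙ]`: for all constants `a₁,…,aₙ`, the marginal weight
`R[A₁,…,Aₙ](a₁,…,aₙ)` is below `S[B₁,…,Bₙ](a₁,…,aₙ)` in the natural order. -/
def KDatabase.Satisfies {Att Rel : Type*} {att : Rel → Finset Att} {Const K : Type*}
    [AddCommMonoid K] {S : Finset Rel} (D : KDatabase att Const K S) (σ : IND att)
    (hσ : σ.Over S) : Prop :=
  ∀ a : Fin σ.arity → Const,
    NatLE (KRelation.marg (D ⟨σ.lhs, hσ.1⟩) σ.lattrs a)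
      (KRelation.marg (D ⟨σ.rhs, hσ.2⟩) σ.rattrs a)

/-- Entailment over `K`-databases: every `K`-database, over any schema that contains the
relation names occurring in `Γ` and `τ`, that satisfies all of `Γ` also satisfies `τ`. -/
def Entails {Att Rel : Type*} {att : Rel → Finset Att} (Const K : Type*) [AddCommMonoid K]
    (Γ : Finset (IND att)) (τ : IND att) : Prop :=
  ∀ (S : Finset Rel) (hΓ : ∀ σ ∈ Γ, σ.Over S) (hτ : τ.Over S) (D : KDatabase att Const K S),
    (∀ (σ : IND att) (h : σ ∈ Γ), D.Satisfies σ (hΓ σ h)) → D.Satisfies τ hτ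

/-- Derivability from `Γ` by reflexivity, transitivity, projection and permutation, and
weak symmetry. -/
inductive Derivable {Att Rel : Type*} {att : Rel → Finset Att} (Γ : Finset (IND att)) :
    IND att → Prop
  | hyp {σ : IND att} (h : σ ∈ Γ) : Derivable Γ σ
  | refl (R : Rel) (n : ℕ) (A : Fin n ↪ {A : Att // A ∈ att R}) :
      Derivable Γ ⟨R, R, n, A, A⟩
  | trans {R S T : Rel} {n : ℕ} {A : Fin n ↪ {A : Att // A ∈ att R}}
      {B : Fin n ↪ {A : Att // A ∈ att S}} {C : Fin n ↪ {A : Att // A ∈ att T}}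
      (h₁ : Derivable Γ ⟨R, S, n, A, B⟩) (h₂ : Derivable Γ ⟨S, T, n, B, C⟩) :
      Derivable Γ ⟨R, T, n, A, C⟩
  | proj {R S : Rel} {n l : ℕ} {A : Fin n ↪ {A : Att // A ∈ att R}}
      {B : Fin n ↪ {A : Att // A ∈ att S}} (i : Fin l ↪ Fin n)
      (h : Derivable Γ ⟨R, S, n, A, B⟩) :
      Derivable Γ ⟨R, S, l, i.trans A, i.trans B⟩
  | weakSymm {R S : Rel} {n : ℕ} {A : Fin n ↪ {A : Att // A ∈ att R}}
      {B : Fin n ↪ {A : Att // A ∈ att S}}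
      (h₁ : Derivable Γ ⟨R, S, n, A, B⟩)
      (h₂ : Derivable Γ ⟨S, R, 0, Function.Embedding.ofIsEmpty, Function.Embedding.ofIsEmpty⟩) :
      Derivable Γ ⟨S, R, n, B, A⟩

/-- A provability relation is sound for an entailment relation, on finite sets of
inclusion dependencies. -/
def IsSound {Att Rel : Type*} {att : Rel → Finset Att}
    (prov ent : Finset (IND att) → IND att → Prop) : Prop :=
  ∀ (Γ : Finset (IND att)) (τ : IND att), prov Γ τ → ent Γ τ

/-- A provability relation is complete for an entailment relation, on finite sets of
inclusion dependencies. -/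
def IsComplete {Att Rel : Type*} {att : Rel → Finset Att}
    (prov ent : Finset (IND att) → IND att → Prop) : Prop :=
  ∀ (Γ : Finset (IND att)) (τ : IND att), ent Γ τ → prov Γ τ

end KDep

/-!
Soundness is an induction on derivations. The only rule that is not immediate is weak symmetry:
if the marginals of `R` are pointwise below those of `S` and the total weight of `S` is below that
of `R`, then the pointwise differences together with the difference of the totals add up to an
element absorbed by the total of `R`, so weak cancellation and positivity make all of them vanish.

For completeness let `τ = R[A₁,…,Aₙ] ≤ S[B₁,…,Bₙ]` be underivable from `Γ`. Multiples of a fixed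
`u ≠ 0` in `K` are ordered like `ℕ` (`natLE_nsmul_iff`), so it suffices to find nonnegative integer
weights that satisfy `Γ` and violate `τ`. Fix distinct constants `w, v₁,…,vₙ`, the function `base`
with value `H` at `w` and `1` at each `vᵢ`, and the functions `bumpᵢ = δ_{vᵢ} - δ_w`, which have sum
zero. For a sequence `C = (C₁,…,Cₙ)` of distinct attributes of `T`, let `bumpTerm C` be the product
over all attributes of `bumpᵢ` at `Cᵢ` and `base` elsewhere. Relation `T` gets the weight
`Z ^ (N - |att T|) * (M T * base ⊗ ⋯ ⊗ base + α * ∑ bumpTerm C)`, where `Z` is the sum of `base`, `N`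
is large, and the sum runs over all `C` such that `R[A] ≤ T[C]` is derivable.

Since the `bumpᵢ` have sum zero, only the terms with `C ⊆ D` survive in the marginal on `D`
(`sum_bumpWeight`), and the marginal has the same shape as the weight itself. Let `T[D] ≤ T'[D']`
be in `Γ`. By projection and transitivity every term on the left has its counterpart on the right.
If `T'[∅] ≤ T[∅]` is derivable, then weak symmetry gives the converse and both sides coincide, as
`M T = M T'`. Otherwise `M T < M T'`, where `M T` is the number of relations below `T`. The surplus
on the right may contain negative bump terms, but these only occur at points having the value `w`
somewhere; there `base ⊗ ⋯ ⊗ base` carries a factor `H`, and for large `H` it dominates them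
(`prod_base_add_nonneg`). The same estimate shows that the weights are nonnegative.

At the point `(v₁,…,vₙ)`, where `base` is `1`, a bump term vanishes unless it comes from the
sequence itself. Up to a common factor `R[A]` has the value `M R + α` there, but `S[B]` has only
the value `M S`, because `R[A] ≤ S[B]` is underivable. So `τ` fails when `α` is at least `M S`.
-/

namespace KDep

/-! ### The natural order of a positive, weakly cancellative monoid -/

theorem NatLE.refl {K : Type*} [AddCommMonoid K] (a : K) : NatLE a a := ⟨0, add_zero a⟩

theorem NatLE.trans {K : Type*} [AddCommMonoid K] {a b c : K} (h₁ : NatLE a b) (h₂ : NatLE b c) :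
    NatLE a c := by
  obtain ⟨x, rfl⟩ := h₁
  obtain ⟨y, rfl⟩ := h₂
  exact ⟨x + y, (add_assoc a x y).symm⟩

theorem NatLE.sum {K ι : Type*} [AddCommMonoid K] {s : Finset ι} {f g : ι → K}
    (h : ∀ i ∈ s, NatLE (f i) (g i)) : NatLE (∑ i ∈ s, f i) (∑ i ∈ s, g i) := by
  choose! c hc using h
  exact ⟨∑ i ∈ s, c i, by rw [← Finset.sum_add_distrib]; exact Finset.sum_congr rfl hc⟩

theorem eq_zero_of_sum_eq_zero {K ι : Type*} [AddCommMonoid K] (hpos : IsPositive K)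
    {s : Finset ι} {f : ι → K} (h : ∑ i ∈ s, f i = 0) {i : ι} (hi : i ∈ s) : f i = 0 := by
  classical
  rw [← Finset.add_sum_erase s f hi] at h
  exact (hpos _ _ h).1

/-- A pointwise inequality between families whose sums are reversely ordered is an equality. -/
theorem eq_of_natLE_of_sum_natLE {K ι : Type*} [AddCommMonoid K] (hpos : IsPositive K)
    (hwc : IsWeaklyCancellative K) {s : Finset ι} {f g : ι → K}
    (hle : ∀ i ∈ s, NatLE (f i) (g i)) (hsum : NatLE (∑ i ∈ s, g i) (∑ i ∈ s, f i))
    {i : ι} (hi : i ∈ s) : f i = g i := by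
  choose! c hc using hle
  obtain ⟨d, hd⟩ := hsum
  have hg : ∑ i ∈ s, g i = ∑ i ∈ s, f i + ∑ i ∈ s, c i := by
    rw [← Finset.sum_add_distrib]
    exact Finset.sum_congr rfl fun i hi => (hc i hi).symm
  have h0 : ∑ i ∈ s, c i + d = 0 := by
    apply hwc _ (∑ i ∈ s, f i)
    rw [add_comm, ← add_assoc, ← hg, hd]
  rw [← hc i hi, eq_zero_of_sum_eq_zero hpos (hpos _ _ h0).1 hi, add_zero]

theorem natLE_nsmul_iff {K : Type*} [AddCommMonoid K] (hpos : IsPositive K)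
    (hwc : IsWeaklyCancellative K) {u : K} (hu : u ≠ 0) {p q : ℕ} :
    NatLE (p • u) (q • u) ↔ p ≤ q := by
  constructor
  · rintro ⟨c, hc⟩
    by_contra! hlt
    obtain ⟨k, rfl⟩ := Nat.exists_eq_add_of_lt hlt
    have h : (u + (k • u + c)) + q • u = q • u := by
      rw [add_nsmul, add_nsmul, one_nsmul] at hc
      calc _ = q • u + k • u + u + c := by abel
        _ = _ := hc
    exact hu (hpos _ _ (hwc _ _ h)).1
  · intro h
    obtain ⟨k, rfl⟩ := Nat.exists_eq_add_of_le h
    exact ⟨k • u, (add_nsmul u p k).symm⟩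

/-! ### Marginals and soundness -/

open Classical in
/-- The marginals of `r` on any sequence of attributes add up to the total weight of `r`, which is
the marginal on the empty sequence. -/
theorem KRelation.sum_marg {Att Const K : Type*} [AddCommMonoid K] {X : Finset Att}
    (r : KRelation Const K X) {n : ℕ} (A : Fin n ↪ {A : Att // A ∈ X})
    {F : Finset (Fin n → Const)} (hF : r.support.image (fun t i => t (A i)) ⊆ F)
    (E : Fin 0 ↪ {A : Att // A ∈ X}) (e : Fin 0 → Const) :
    ∑ a ∈ F, r.marg A a = r.marg E e := by
  have hmaps : ∀ t ∈ r.support, (fun i => t (A i)) ∈ F := fun t ht =>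
    hF (Finset.mem_image_of_mem _ ht)
  have htot : r.marg E e = ∑ t ∈ r.support, r t := by
    unfold KRelation.marg
    rw [Finset.filter_true_of_mem]
    exact fun t _ i => i.elim0
  rw [htot, ← Finset.sum_fiberwise_of_maps_to hmaps]
  refine Finset.sum_congr rfl fun a _ => ?_
  unfold KRelation.marg
  refine Finset.sum_congr ?_ fun _ _ => rfl
  ext t
  simp [funext_iff]

theorem marg_eq_of_natLE_of_total {Att Const K : Type*} [AddCommMonoid K] (hpos : IsPositive K)
    (hwc : IsWeaklyCancellative K) {X Y : Finset Att} {r : KRelation Const K X}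
    {s : KRelation Const K Y} {n : ℕ} {A : Fin n ↪ {A : Att // A ∈ X}}
    {B : Fin n ↪ {B : Att // B ∈ Y}} (h : ∀ a, NatLE (r.marg A a) (s.marg B a))
    {E : Fin 0 ↪ {A : Att // A ∈ X}} {E' : Fin 0 ↪ {B : Att // B ∈ Y}}
    (h₀ : ∀ e, NatLE (s.marg E' e) (r.marg E e)) (a : Fin n → Const) :
    r.marg A a = s.marg B a := by
  classical
  let F : Finset (Fin n → Const) := insert a
    (r.support.image (fun t i => t (A i)) ∪ s.support.image (fun t i => t (B i)))
  refine eq_of_natLE_of_sum_natLE hpos hwc (s := F) (fun b _ => h b) ?_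
    (Finset.mem_insert_self _ _)
  rw [r.sum_marg A (Finset.subset_union_left.trans (Finset.subset_insert _ _)) E Fin.elim0,
    s.sum_marg B (Finset.subset_union_right.trans (Finset.subset_insert _ _)) E' Fin.elim0]
  exact h₀ _

open Classical in
/-- A marginal on a subsequence is a sum of marginals on the whole sequence. -/
theorem KRelation.marg_trans {Att Const K : Type*} [AddCommMonoid K] {X : Finset Att}
    (r : KRelation Const K X) {n l : ℕ} (A : Fin n ↪ {A : Att // A ∈ X}) (i : Fin l ↪ Fin n)
    {F : Finset (Fin n → Const)} (hF : r.support.image (fun t i => t (A i)) ⊆ F)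
    (a : Fin l → Const) :
    r.marg (i.trans A) a = ∑ b ∈ F with (∀ j, b (i j) = a j), r.marg A b := by
  have hmaps : ∀ t ∈ r.support.filter (fun t => ∀ j, t ((i.trans A) j) = a j),
      (fun k => t (A k)) ∈ F.filter (fun b => ∀ j, b (i j) = a j) := by
    intro t ht
    rw [Finset.mem_filter] at ht ⊢
    exact ⟨hF (Finset.mem_image_of_mem _ ht.1), ht.2⟩
  unfold KRelation.marg
  rw [← Finset.sum_fiberwise_of_maps_to hmaps]
  refine Finset.sum_congr rfl fun b hb => Finset.sum_congr ?_ fun _ _ => rfl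
  ext t
  simp only [Finset.mem_filter, funext_iff, Function.Embedding.trans_apply] at hb ⊢
  constructor
  · rintro ⟨⟨h₁, -⟩, h₂⟩
    exact ⟨h₁, h₂⟩
  · rintro ⟨h₁, h₂⟩
    exact ⟨⟨h₁, fun j => by rw [h₂, hb.2]⟩, h₂⟩

theorem Derivable.lhs_mem_iff {Att Rel : Type*} {att : Rel → Finset Att} {Γ : Finset (IND att)}
    {σ : IND att} (h : Derivable Γ σ) {S : Finset Rel} (hΓ : ∀ σ ∈ Γ, σ.Over S) :
    σ.lhs ∈ S ↔ σ.rhs ∈ S := by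
  induction h with
  | hyp h => exact iff_of_true (hΓ _ h).1 (hΓ _ h).2
  | refl => exact Iff.rfl
  | trans _ _ ih₁ ih₂ => exact ih₁.trans ih₂
  | proj _ _ ih => exact ih
  | weakSymm _ _ ih _ => exact ih.symm

theorem Derivable.entails {Att Rel : Type*} {att : Rel → Finset Att} {Const K : Type*}
    [AddCommMonoid K] (hpos : IsPositive K) (hwc : IsWeaklyCancellative K)
    {Γ : Finset (IND att)} {τ : IND att} (h : Derivable Γ τ) : Entails Const K Γ τ := by
  classical
  intro S hΓ hτ D hD
  induction h with
  | hyp h => exact hD _ h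
  | refl => exact fun a => NatLE.refl _
  | trans h₁ h₂ ih₁ ih₂ =>
    have hS := (h₁.lhs_mem_iff hΓ).1 hτ.1
    exact fun a => (ih₁ ⟨hτ.1, hS⟩ a).trans (ih₂ ⟨hS, hτ.2⟩ a)
  | @proj R T n l A B i _ ih =>
    intro a
    let F : Finset (Fin n → Const) :=
      ((D ⟨R, hτ.1⟩).support.image fun t k => t (A k)) ∪
        ((D ⟨T, hτ.2⟩).support.image fun t k => t (B k))
    have hR := (D ⟨R, hτ.1⟩).marg_trans A i (F := F) Finset.subset_union_left a
    have hT := (D ⟨T, hτ.2⟩).marg_trans B i (F := F) Finset.subset_union_right a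
    change NatLE ((D ⟨R, hτ.1⟩).marg (i.trans A) a) ((D ⟨T, hτ.2⟩).marg (i.trans B) a)
    rw [hR, hT]
    exact NatLE.sum fun b _ => ih hτ b
  | weakSymm _ _ ih₁ ih₂ =>
    intro a
    have := marg_eq_of_natLE_of_total hpos hwc (ih₁ hτ.symm) (ih₂ hτ) a
    exact this ▸ NatLE.refl _

/-! ### Base and bump functions on constants -/

section Weights

variable {Const : Type*} {n : ℕ}

open Classical in
/-- The function with value `H` at `v none` and value `1` at each `v (some p)`. -/
noncomputable def base (v : Option (Fin n) ↪ Const) (H : ℤ) (c : Const) : ℤ :=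
  if c = v none then H else if c ∈ Set.range v then 1 else 0

open Classical in
/-- The difference of the indicators of `v (some p)` and `v none`. -/
noncomputable def bump (v : Option (Fin n) ↪ Const) (p : Fin n) (c : Const) : ℤ :=
  if c = v (some p) then 1 else if c = v none then -1 else 0

/-- The product over `j` of `bump v p` at the position `j = C p` and of `base v H` at the positions
outside the range of `C`. -/
noncomputable def bumpTerm (v : Option (Fin n) ↪ Const) (H : ℤ) {J : Type*} [Fintype J]
    (C : Fin n ↪ J) (x : J → Const) : ℤ :=
  ∏ j, Function.extend C (bump v) (fun _ => base v H) j (x j)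

/-- The weight with amplitude `M` for the product of the base functions, and amplitude `α` for
the bump terms of the sequences in `I`. -/
noncomputable def bumpWeight (v : Option (Fin n) ↪ Const) (H M α : ℤ) {J : Type*} [Fintype J]
    (I : Finset (Fin n ↪ J)) (x : J → Const) : ℤ :=
  M * ∏ j, base v H (x j) + α * ∑ C ∈ I, bumpTerm v H C x

theorem base_nonneg (v : Option (Fin n) ↪ Const) {H : ℤ} (hH : 1 ≤ H) (c : Const) :
    0 ≤ base v H c := by
  unfold base
  split_ifs <;> lia

theorem base_some (v : Option (Fin n) ↪ Const) (H : ℤ) (p : Fin n) :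
    base v H (v (some p)) = 1 := by
  simp [base]

theorem bump_some (v : Option (Fin n) ↪ Const) (p q : Fin n) :
    bump v p (v (some q)) = if q = p then 1 else 0 := by
  simp [bump]

theorem base_eq_zero (v : Option (Fin n) ↪ Const) (H : ℤ) {c : Const}
    (hc : c ∉ Finset.univ.map v) : base v H c = 0 := by
  have h : ∀ o, v o ≠ c := by simpa using hc
  simp [base, h, (h none).symm]

theorem bump_eq_zero (v : Option (Fin n) ↪ Const) (p : Fin n) {c : Const}
    (hc : c ∉ Finset.univ.map v) : bump v p c = 0 := by
  have h : ∀ o, v o ≠ c := by simpa using hc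
  simp [bump, (h _).symm]

theorem sum_bump (v : Option (Fin n) ↪ Const) (p : Fin n) :
    ∑ c ∈ Finset.univ.map v, bump v p c = 0 := by
  rw [Finset.sum_map, Fintype.sum_option]
  simp only [bump_some, Finset.sum_ite_eq', Finset.mem_univ, if_true]
  simp [bump]

theorem sum_base_pos (v : Option (Fin n) ↪ Const) {H : ℤ} (hH : 1 ≤ H) :
    0 < ∑ c ∈ Finset.univ.map v, base v H c := by
  rw [Finset.sum_map, Fintype.sum_option]
  simp only [base_some]
  simp [base]
  lia

theorem abs_bump_le (v : Option (Fin n) ↪ Const) {H : ℤ} (hH : 1 ≤ H) (p : Fin n) (c : Const) :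
    |bump v p c| ≤ base v H c := by
  unfold bump base
  split_ifs with h₁ h₂ h₃ <;> simp_all

theorem base_eq_of_bump_neg (v : Option (Fin n) ↪ Const) (H : ℤ) {p : Fin n} {c : Const}
    (h : bump v p c < 0) : |bump v p c| = 1 ∧ base v H c = H := by
  unfold bump at *
  unfold base
  split_ifs at * <;> simp_all

/-- A negative bump term has a factor `-1` at some position where `base` is `H`. -/
theorem neg_prod_base_le (v : Option (Fin n) ↪ Const) {H : ℤ} (hH : 1 ≤ H) {J : Type*} [Fintype J]
    (C : Fin n ↪ J) (x : J → Const) :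
    -∏ j, base v H (x j) ≤ H * bumpTerm v H C x := by
  classical
  set g := Function.extend C (bump v) (fun _ => base v H) with hg
  have hcase : ∀ j, (∃ p, g j = bump v p) ∨ g j = base v H := by
    intro j
    by_cases hj : ∃ p, C p = j
    · obtain ⟨p, rfl⟩ := hj
      exact Or.inl ⟨p, C.injective.extend_apply _ _ p⟩
    · exact Or.inr (Function.extend_apply' _ _ _ hj)
  have hle : ∀ j, |g j (x j)| ≤ base v H (x j) := by
    intro j
    obtain ⟨p, hp⟩ | hb := hcase j
    · rw [hp]
      exact abs_bump_le v hH p _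
    · rw [hb, abs_of_nonneg (base_nonneg v hH _)]
  have hb0 : ∀ j, 0 ≤ base v H (x j) := fun j => base_nonneg v hH _
  by_cases hneg : ∃ j, g j (x j) < 0
  · obtain ⟨j, hj⟩ := hneg
    have hfac : |g j (x j)| = 1 ∧ base v H (x j) = H := by
      obtain ⟨p, hp⟩ | hb := hcase j
      · rw [hp] at hj ⊢
        exact base_eq_of_bump_neg v H hj
      · rw [hb] at hj
        exact absurd hj (hb0 j).not_gt
    have habs : H * |bumpTerm v H C x| ≤ ∏ j, base v H (x j) := by
      rw [bumpTerm, ← hg, Finset.abs_prod, ← Finset.mul_prod_erase _ _ (Finset.mem_univ j),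
        ← Finset.mul_prod_erase Finset.univ (fun j => base v H (x j)) (Finset.mem_univ j),
        hfac.1, hfac.2, one_mul]
      exact mul_le_mul_of_nonneg_left
        (Finset.prod_le_prod (fun i _ => abs_nonneg _) fun i _ => hle i) (by lia)
    nlinarith [neg_abs_le (bumpTerm v H C x)]
  · push Not at hneg
    have h1 : 0 ≤ bumpTerm v H C x := Finset.prod_nonneg fun j _ => hneg j
    have h2 : 0 ≤ ∏ j, base v H (x j) := Finset.prod_nonneg fun j _ => hb0 j
    nlinarith

/-- For large `H` the product of the base functions dominates the bump terms. -/
theorem prod_base_add_nonneg (v : Option (Fin n) ↪ Const) {H α : ℤ} (hH : 1 ≤ H) (hα : 0 ≤ α)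
    {J : Type*} [Fintype J] (I : Finset (Fin n ↪ J)) (hI : α * I.card ≤ H) (x : J → Const) :
    0 ≤ ∏ j, base v H (x j) + α * ∑ C ∈ I, bumpTerm v H C x := by
  set b := ∏ j, base v H (x j) with hb
  have hb0 : 0 ≤ b := Finset.prod_nonneg fun j _ => base_nonneg v hH _
  have hsum : -(I.card * b) ≤ H * ∑ C ∈ I, bumpTerm v H C x := by
    rw [Finset.mul_sum]
    calc -(I.card * b) = ∑ _C ∈ I, -b := by simp
      _ ≤ _ := Finset.sum_le_sum fun C _ => neg_prod_base_le v hH C x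
  have h1 := mul_le_mul_of_nonneg_left hsum hα
  have h2 := mul_le_mul_of_nonneg_right hI hb0
  have h3 : 0 ≤ H * (b + α * ∑ C ∈ I, bumpTerm v H C x) := by linarith
  exact nonneg_of_mul_nonneg_right h3 (by lia)

theorem bumpWeight_nonneg (v : Option (Fin n) ↪ Const) {H M α : ℤ} (hH : 1 ≤ H) (hM : 1 ≤ M)
    (hα : 0 ≤ α) {J : Type*} [Fintype J] (I : Finset (Fin n ↪ J)) (hI : α * I.card ≤ H)
    (x : J → Const) : 0 ≤ bumpWeight v H M α I x := by
  have h1 := prod_base_add_nonneg v hH hα I hI x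
  have h2 : 0 ≤ ∏ j, base v H (x j) := Finset.prod_nonneg fun j _ => base_nonneg v hH _
  unfold bumpWeight
  nlinarith

theorem bumpWeight_mono (v : Option (Fin n) ↪ Const) {H M M' α : ℤ} (hH : 1 ≤ H) (hM : M < M')
    (hα : 0 ≤ α) {J : Type*} [Fintype J] {I I' : Finset (Fin n ↪ J)} (hII : I ⊆ I')
    (hI : α * I'.card ≤ H) (x : J → Const) :
    bumpWeight v H M α I x ≤ bumpWeight v H M' α I' x := by
  classical
  have hcard : α * (I' \ I).card ≤ H := by
    refine le_trans (mul_le_mul_of_nonneg_left ?_ hα) hI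
    exact_mod_cast Finset.card_le_card Finset.sdiff_subset
  have h1 := prod_base_add_nonneg v hH hα (I' \ I) hcard x
  have h2 : 0 ≤ ∏ j, base v H (x j) := Finset.prod_nonneg fun j _ => base_nonneg v hH _
  unfold bumpWeight
  rw [← Finset.sum_sdiff hII]
  nlinarith

open Classical in
/-- At the point `p ↦ v (some p)` the only bump term that does not vanish is that of the identity
embedding. -/
theorem bumpWeight_some (v : Option (Fin n) ↪ Const) (H M α : ℤ) (I : Finset (Fin n ↪ Fin n)) :
    bumpWeight v H M α I (fun p => v (some p)) =
      M + if Function.Embedding.refl _ ∈ I then α else 0 := by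
  have hterm : ∀ C : Fin n ↪ Fin n, bumpTerm v H C (fun p => v (some p)) =
      if C = Function.Embedding.refl _ then 1 else 0 := by
    intro C
    split_ifs with hC
    · subst hC
      refine Finset.prod_eq_one fun p _ => ?_
      have := (Function.Embedding.refl (Fin n)).injective.extend_apply (bump v)
        (fun _ => base v H) p
      rw [Function.Embedding.refl_apply] at this
      rw [this, bump_some, if_pos rfl]
    · obtain ⟨p, hp⟩ : ∃ p, C p ≠ p := by
        by_contra! h
        exact hC (Function.Embedding.ext h)
      refine Finset.prod_eq_zero (Finset.mem_univ (C p)) ?_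
      rw [C.injective.extend_apply, bump_some, if_neg hp]
  unfold bumpWeight
  simp [base_some, hterm]

/-! ### Marginals of products -/

open Classical in
/-- The marginal of a product of functions of the single coordinates. -/
theorem sum_filter_prod {J : Type*} [Fintype J] {m : ℕ} (D : Fin m ↪ J) (V : Finset Const)
    (g : J → Const → ℤ) (hg : ∀ j, ∀ c ∉ V, g j c = 0) (a : Fin m → Const) :
    ∑ x ∈ Fintype.piFinset (fun _ : J => V) with (∀ l, x (D l) = a l), ∏ j, g j (x j) =
      (∏ j ∈ (Finset.univ.map D)ᶜ, ∑ c ∈ V, g j c) * ∏ l, g (D l) (a l) := by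
  let h : J → Const → ℤ := fun j c => if ∀ l, D l = j → c = a l then g j c else 0
  have hprod : ∀ x : J → Const, (if ∀ l, x (D l) = a l then ∏ j, g j (x j) else 0) =
      ∏ j, h j (x j) := by
    intro x
    split_ifs with hx
    · refine Finset.prod_congr rfl fun j _ => ?_
      exact (if_pos (by rintro l rfl; exact hx l)).symm
    · push Not at hx
      obtain ⟨l, hl⟩ := hx
      refine (Finset.prod_eq_zero (Finset.mem_univ (D l)) (if_neg ?_)).symm
      exact fun hall => hl (hall l rfl)
  rw [Finset.sum_filter, Finset.sum_congr rfl fun x _ => hprod x,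
    Finset.sum_prod_piFinset V h, ← Finset.prod_compl_mul_prod (Finset.univ.map D),
    Finset.prod_map]
  congr 1
  · refine Finset.prod_congr rfl fun j hj => Finset.sum_congr rfl fun c _ => if_pos ?_
    intro l hl
    simp only [Finset.mem_compl, Finset.mem_map, Finset.mem_univ, true_and, not_exists] at hj
    exact absurd hl (hj l)
  · refine Finset.prod_congr rfl fun l _ => ?_
    have hl : ∀ c, h (D l) c = if c = a l then g (D l) (a l) else 0 := by
      intro c
      by_cases hc : c = a l
      · subst hc
        simp only [h, if_true]
        rw [if_pos]
        intro l' hl'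
        rw [D.injective hl']
      · rw [if_neg hc]
        exact if_neg fun hall => hc (hall l rfl)
    rw [Finset.sum_congr rfl fun c _ => hl c, Finset.sum_ite_eq']
    split_ifs with ha
    · rfl
    · exact (hg _ _ ha).symm

open Classical in
theorem sum_prod_base (v : Option (Fin n) ↪ Const) (H : ℤ) {J : Type*} [Fintype J] {m : ℕ}
    (D : Fin m ↪ J) (a : Fin m → Const) :
    ∑ x ∈ Fintype.piFinset (fun _ : J => Finset.univ.map v) with (∀ l, x (D l) = a l),
        ∏ j, base v H (x j) =
      (∑ c ∈ Finset.univ.map v, base v H c) ^ (Fintype.card J - m) * ∏ l, base v H (a l) := by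
  rw [sum_filter_prod D _ (fun _ => base v H) fun _ _ hc => base_eq_zero v H hc]
  simp [Finset.card_compl]

theorem extend_eq_zero (v : Option (Fin n) ↪ Const) (H : ℤ) {J : Type*} (C : Fin n ↪ J) (j : J)
    {c : Const} (hc : c ∉ Finset.univ.map v) :
    Function.extend C (bump v) (fun _ => base v H) j c = 0 := by
  by_cases hj : ∃ p, C p = j
  · obtain ⟨p, rfl⟩ := hj
    rw [C.injective.extend_apply]
    exact bump_eq_zero v p hc
  · rw [Function.extend_apply' _ _ _ hj]
    exact base_eq_zero v H hc

open Classical in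
/-- The marginal on `D` of the bump term of a subsequence of `D` is again a bump term. -/
theorem sum_bumpTerm_trans (v : Option (Fin n) ↪ Const) (H : ℤ) {J : Type*} [Fintype J] {m : ℕ}
    (D : Fin m ↪ J) (i : Fin n ↪ Fin m) (a : Fin m → Const) :
    ∑ x ∈ Fintype.piFinset (fun _ : J => Finset.univ.map v) with (∀ l, x (D l) = a l),
        bumpTerm v H (i.trans D) x =
      (∑ c ∈ Finset.univ.map v, base v H c) ^ (Fintype.card J - m) * bumpTerm v H i a := by
  unfold bumpTerm
  rw [sum_filter_prod D _ _ fun j _ hc => extend_eq_zero v H (i.trans D) j hc]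
  congr 1
  · rw [Finset.prod_congr rfl (g := fun _ => ∑ c ∈ Finset.univ.map v, base v H c)]
    · simp [Finset.card_compl]
    · intro j hj
      rw [Function.extend_apply']
      rintro ⟨p, rfl⟩
      simp at hj
  · refine Finset.prod_congr rfl fun l _ => ?_
    by_cases hl : ∃ p, i p = l
    · obtain ⟨p, rfl⟩ := hl
      rw [i.injective.extend_apply]
      exact congrFun ((i.trans D).injective.extend_apply (bump v) (fun _ => base v H) p) _
    · rw [Function.extend_apply' _ _ _ hl, Function.extend_apply']
      rintro ⟨p, hp⟩
      exact hl ⟨p, D.injective hp⟩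

open Classical in
/-- The marginal on `D` of the bump term of a sequence not contained in `D` vanishes. -/
theorem sum_bumpTerm_eq_zero (v : Option (Fin n) ↪ Const) (H : ℤ) {J : Type*} [Fintype J] {m : ℕ}
    (D : Fin m ↪ J) (C : Fin n ↪ J) (hC : C ∉ Set.range fun i : Fin n ↪ Fin m => i.trans D)
    (a : Fin m → Const) :
    ∑ x ∈ Fintype.piFinset (fun _ : J => Finset.univ.map v) with (∀ l, x (D l) = a l),
        bumpTerm v H C x = 0 := by
  unfold bumpTerm
  rw [sum_filter_prod D _ _ fun j _ hc => extend_eq_zero v H C j hc]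
  obtain ⟨p, hp⟩ : ∃ p, ∀ l, D l ≠ C p := by
    by_contra! h
    choose i hi using h
    refine hC ⟨⟨i, fun p q hpq => C.injective ?_⟩, Function.Embedding.ext hi⟩
    rw [← hi, ← hi, hpq]
  rw [Finset.prod_eq_zero (i := C p), zero_mul]
  · simpa using hp
  · rw [C.injective.extend_apply]
    exact sum_bump v p

open Classical in
/-- The marginal on `D` of a weight is a multiple of a weight of the same shape, in which exactly
the bump terms of the subsequences of `D` survive. -/
theorem sum_bumpWeight (v : Option (Fin n) ↪ Const) (H M α : ℤ) {J : Type*} [Fintype J] {m : ℕ}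
    (P : (Fin n ↪ J) → Prop) (D : Fin m ↪ J) (a : Fin m → Const) :
    ∑ x ∈ Fintype.piFinset (fun _ : J => Finset.univ.map v) with (∀ l, x (D l) = a l),
        bumpWeight v H M α (Finset.univ.filter P) x =
      (∑ c ∈ Finset.univ.map v, base v H c) ^ (Fintype.card J - m) *
        bumpWeight v H M α (Finset.univ.filter fun i => P (i.trans D)) a := by
  unfold bumpWeight
  rw [Finset.sum_add_distrib, ← Finset.mul_sum, ← Finset.mul_sum, sum_prod_base, Finset.sum_comm]
  have hre : ∑ C with P C,
      ∑ x ∈ Fintype.piFinset (fun _ : J => Finset.univ.map v) with (∀ l, x (D l) = a l),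
        bumpTerm v H C x =
      ∑ i : Fin n ↪ Fin m with P (i.trans D),
        (∑ c ∈ Finset.univ.map v, base v H c) ^ (Fintype.card J - m) * bumpTerm v H i a := by
    symm
    refine Finset.sum_of_injOn (fun i => i.trans D) ?_ ?_ ?_ ?_
    · intro i _ i' _ h
      exact Function.Embedding.ext fun p => D.injective (DFunLike.congr_fun h p)
    · intro i hi
      simpa using hi
    · intro C hC hC'
      refine sum_bumpTerm_eq_zero v H D C ?_ a
      rintro ⟨i, rfl⟩
      exact hC' ⟨i, by simpa using hC, rfl⟩
    · intro i _
      exact (sum_bumpTerm_trans v H D i a).symm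
  rw [hre, ← Finset.mul_sum]
  ring

end Weights

/-! ### Databases with integer weights -/

open Classical in
/-- The `K`-relation with weight `(f t).toNat • u` at the tuples `t` with values in `V`, and weight
`0` elsewhere. -/
noncomputable def multRelation {Att Const K : Type*} [AddCommMonoid K] {X : Finset Att} (u : K)
    (V : Finset Const) (f : Tup Const X → ℤ) : KRelation Const K X :=
  Finsupp.onFinset (Fintype.piFinset fun _ => V)
    (fun t => if t ∈ Fintype.piFinset (fun _ => V) then (f t).toNat • u else 0)
    (fun t ht => by by_contra h; exact ht (if_neg h))

open Classical in
theorem multRelation_marg {Att Const K : Type*} [AddCommMonoid K] {X : Finset Att} (u : K)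
    (V : Finset Const) (f : Tup Const X → ℤ) (hf : ∀ t, 0 ≤ f t) {m : ℕ}
    (D : Fin m ↪ {A : Att // A ∈ X}) (a : Fin m → Const) :
    (multRelation u V f).marg D a =
      (∑ t ∈ Fintype.piFinset (fun _ => V) with (∀ l, t (D l) = a l), f t).toNat • u := by
  have hnat : (∑ t ∈ Fintype.piFinset (fun _ => V) with (∀ l, t (D l) = a l), f t).toNat =
      ∑ t ∈ Fintype.piFinset (fun _ => V) with (∀ l, t (D l) = a l), (f t).toNat := by
    zify
    rw [Int.toNat_of_nonneg (Finset.sum_nonneg fun t _ => hf t)]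
    exact Finset.sum_congr rfl fun t _ => (Int.toNat_of_nonneg (hf t)).symm
  rw [hnat, Finset.sum_smul]
  unfold KRelation.marg
  have hsub : (multRelation u V f).support ⊆ Fintype.piFinset (fun _ => V) :=
    Finsupp.support_onFinset_subset
  rw [Finset.sum_subset (Finset.filter_subset_filter _ hsub)]
  · refine Finset.sum_congr rfl fun t ht => ?_
    exact if_pos (Finset.mem_filter.1 ht).1
  · intro t ht ht'
    by_contra h
    exact ht' (Finset.mem_filter.2 ⟨Finsupp.mem_support_iff.2 h, (Finset.mem_filter.1 ht).2⟩)

/-! ### Completeness -/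

/-- The inclusion dependency `R[∅] ≤ S[∅]`. -/
def totalIND {Att Rel : Type*} (att : Rel → Finset Att) (R S : Rel) : IND att :=
  ⟨R, S, 0, Function.Embedding.ofIsEmpty, Function.Embedding.ofIsEmpty⟩

theorem Derivable.total {Att Rel : Type*} {att : Rel → Finset Att} {Γ : Finset (IND att)}
    {σ : IND att} (h : Derivable Γ σ) : Derivable Γ (totalIND att σ.lhs σ.rhs) := by
  have := Derivable.proj (Function.Embedding.ofIsEmpty : Fin 0 ↪ Fin σ.arity) h
  rwa [Subsingleton.elim (Function.Embedding.trans _ σ.lattrs) Function.Embedding.ofIsEmpty,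
    Subsingleton.elim (Function.Embedding.trans _ σ.rattrs) Function.Embedding.ofIsEmpty] at this

open Classical in
/-- The number of relation names `T` in `S` such that `T[∅] ≤ R[∅]` is derivable. -/
noncomputable def rank {Att Rel : Type*} {att : Rel → Finset Att} (Γ : Finset (IND att))
    (S : Finset Rel) (R : Rel) : ℕ :=
  (S.filter fun T => Derivable Γ (totalIND att T R)).card

open Classical in
theorem rank_pos {Att Rel : Type*} {att : Rel → Finset Att} (Γ : Finset (IND att))
    {S : Finset Rel} {R : Rel} (hR : R ∈ S) : 1 ≤ rank Γ S R :=
  Finset.card_pos.2 ⟨R, Finset.mem_filter.2 ⟨hR, Derivable.refl _ _ _⟩⟩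

open Classical in
theorem rank_le {Att Rel : Type*} {att : Rel → Finset Att} (Γ : Finset (IND att))
    (S : Finset Rel) (R : Rel) : rank Γ S R ≤ S.card :=
  Finset.card_filter_le _ _

open Classical in
theorem rank_mono {Att Rel : Type*} {att : Rel → Finset Att} {Γ : Finset (IND att)}
    (S : Finset Rel) {R T : Rel} (h : Derivable Γ (totalIND att R T)) :
    rank Γ S R ≤ rank Γ S T :=
  Finset.card_le_card (Finset.monotone_filter_right _ fun _ _ hU => Derivable.trans hU h)

open Classical in
theorem rank_lt {Att Rel : Type*} {att : Rel → Finset Att} {Γ : Finset (IND att)}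
    {S : Finset Rel} {R T : Rel} (hT : T ∈ S) (h : Derivable Γ (totalIND att R T))
    (h' : ¬ Derivable Γ (totalIND att T R)) : rank Γ S R < rank Γ S T := by
  refine Finset.card_lt_card (Finset.ssubset_iff_of_subset
    (Finset.monotone_filter_right _ fun _ _ hU => Derivable.trans hU h) |>.2 ⟨T, ?_, ?_⟩)
  · exact Finset.mem_filter.2 ⟨hT, Derivable.refl _ _ _⟩
  · exact fun hmem => h' (Finset.mem_filter.1 hmem).2

theorem card_embedding_filter_le {n m : ℕ} {J : Type*} [Fintype J] (D : Fin m ↪ J)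
    (I : Finset (Fin n ↪ Fin m)) : I.card ≤ Fintype.card (Fin n ↪ J) := by
  classical
  refine (Finset.card_le_univ I).trans (Fintype.card_le_of_injective (fun i => i.trans D) ?_)
  intro i i' h
  exact Function.Embedding.ext fun p => D.injective (DFunLike.congr_fun h p)

theorem derivable_of_entails {Att Const Rel : Type*} [Infinite Const] {att : Rel → Finset Att}
    {K : Type*} [AddCommMonoid K] [Nontrivial K] (hpos : IsPositive K)
    (hwc : IsWeaklyCancellative K) {Γ : Finset (IND att)} {τ : IND att}
    (h : Entails Const K Γ τ) : Derivable Γ τ := by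
  classical
  by_contra hτ
  obtain ⟨u, hu⟩ := exists_ne (0 : K)
  obtain ⟨R, R', n, A, B⟩ := τ
  obtain ⟨v⟩ : Nonempty (Option (Fin n) ↪ Const) :=
    Cardinal.lift_mk_le'.1 ((Cardinal.lift_lt_aleph0.2 (Cardinal.lt_aleph0_of_finite _)).le.trans
      (Cardinal.aleph0_le_lift.2 (Cardinal.aleph0_le_mk Const)))
  set S : Finset Rel := insert R (insert R' (Γ.image IND.lhs ∪ Γ.image IND.rhs)) with hS
  have hΓ : ∀ σ ∈ Γ, σ.Over S := fun σ hσ =>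
    ⟨by simp only [hS, Finset.mem_insert, Finset.mem_union]
        exact Or.inr (Or.inr (Or.inl (Finset.mem_image_of_mem _ hσ))),
      by simp only [hS, Finset.mem_insert, Finset.mem_union]
         exact Or.inr (Or.inr (Or.inr (Finset.mem_image_of_mem _ hσ)))⟩
  have hRS : R ∈ S := by simp [hS]
  have hRS' : R' ∈ S := by simp [hS]
  -- `α` is at least the rank of `R'`, and `H` is at least `α` times the number of bump terms.
  set α : ℤ := (S.card : ℤ)
  have hα0 : 0 ≤ α := by positivity
  set H : ℤ := 1 + ∑ T ∈ S, α * Fintype.card (Fin n ↪ {A : Att // A ∈ att T})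
  have hH : 1 ≤ H := by
    have : 0 ≤ ∑ T ∈ S, α * (Fintype.card (Fin n ↪ {A : Att // A ∈ att T}) : ℤ) := by positivity
    lia
  have hcard : ∀ T ∈ S, α * (Fintype.card (Fin n ↪ {A : Att // A ∈ att T}) : ℤ) ≤ H := by
    intro T hT
    have := Finset.single_le_sum
      (f := fun T => α * (Fintype.card (Fin n ↪ {A : Att // A ∈ att T}) : ℤ))
      (fun T _ => by positivity) hT
    lia
  set N : ℕ := ∑ T ∈ S, (att T).card
  have hNle : ∀ T ∈ S, (att T).card ≤ N := fun T hT =>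
    Finset.single_le_sum (f := fun T => (att T).card) (fun _ _ => Nat.zero_le _) hT
  set Z : ℤ := ∑ c ∈ Finset.univ.map v, base v H c with hZdef
  have hZ : 0 < Z := sum_base_pos v hH
  let P : ∀ T : Rel, (Fin n ↪ {A : Att // A ∈ att T}) → Prop :=
    fun T C => Derivable Γ ⟨R, T, n, A, C⟩
  let f : ∀ T : Rel, Tup Const (att T) → ℤ := fun T t =>
    Z ^ (N - (att T).card) * bumpWeight v H (rank Γ S T) α (Finset.univ.filter (P T)) t
  have hf : ∀ T ∈ S, ∀ t, 0 ≤ f T t := by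
    intro T hT t
    refine mul_nonneg (by positivity) (bumpWeight_nonneg v hH ?_ hα0 _ ?_ t)
    · exact_mod_cast rank_pos Γ hT
    · refine le_trans (mul_le_mul_of_nonneg_left ?_ hα0) (hcard T hT)
      exact_mod_cast Finset.card_le_univ _
  let D : KDatabase att Const K S := fun T => multRelation u (Finset.univ.map v) (f T.1)
  have hmarg : ∀ T (hT : T ∈ S) (m : ℕ) (E : Fin m ↪ {A : Att // A ∈ att T}) (a : Fin m → Const),
      (D ⟨T, hT⟩).marg E a = (Z ^ (N - m) * bumpWeight v H (rank Γ S T) α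
        (Finset.univ.filter fun i => P T (i.trans E)) a).toNat • u := by
    intro T hT m E a
    have hm : m ≤ (att T).card := by simpa using Fintype.card_le_of_embedding E
    have hNT := hNle T hT
    change (multRelation u (Finset.univ.map v) (f T)).marg E a = _
    have hsum := sum_bumpWeight v H (rank Γ S T) α (P T) E a
    rw [← hZdef, Fintype.card_coe] at hsum
    rw [multRelation_marg _ _ _ (hf T hT), ← Finset.mul_sum,
      show N - m = N - (att T).card + ((att T).card - m) by lia, pow_add, mul_assoc]
    congr 3
    convert hsum
  have hsat : ∀ (σ : IND att) (hσ : σ ∈ Γ), D.Satisfies σ (hΓ σ hσ) := by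
    rintro ⟨T, T', m, E, E'⟩ hσ a
    have hd := Derivable.hyp hσ
    obtain ⟨hT, hT'⟩ := hΓ _ hσ
    change NatLE ((D ⟨T, hT⟩).marg E a) ((D ⟨T', hT'⟩).marg E' a)
    rw [hmarg, hmarg, natLE_nsmul_iff hpos hwc hu]
    refine Int.toNat_le_toNat (mul_le_mul_of_nonneg_left ?_ (by positivity))
    have hsub : (Finset.univ.filter fun i : Fin n ↪ Fin m => P T (i.trans E)) ⊆
        Finset.univ.filter fun i => P T' (i.trans E') :=
      Finset.monotone_filter_right _ fun i _ hi => Derivable.trans hi (Derivable.proj i hd)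
    by_cases hback : Derivable Γ (totalIND att T' T)
    · -- Relations with interderivable totals receive equal marginals.
      have hsub' : (Finset.univ.filter fun i : Fin n ↪ Fin m => P T' (i.trans E')) ⊆
          Finset.univ.filter fun i => P T (i.trans E) :=
        Finset.monotone_filter_right _ fun i _ hi =>
          Derivable.trans hi (Derivable.proj i (Derivable.weakSymm hd hback))
      rw [hsub.antisymm hsub', (rank_mono S hd.total).antisymm (rank_mono S hback)]
    · refine bumpWeight_mono v hH ?_ hα0 hsub ?_ a
      · exact_mod_cast rank_lt hT' hd.total hback
      · refine le_trans (mul_le_mul_of_nonneg_left ?_ hα0) (hcard T' hT')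
        exact_mod_cast card_embedding_filter_le E' _
  have hle := h S hΓ ⟨hRS, hRS'⟩ D hsat fun p => v (some p)
  change NatLE ((D ⟨R, hRS⟩).marg A _) ((D ⟨R', hRS'⟩).marg B _) at hle
  rw [hmarg, hmarg, natLE_nsmul_iff hpos hwc hu, bumpWeight_some, bumpWeight_some, if_pos,
    if_neg] at hle
  · have h1 : (1 : ℤ) ≤ rank Γ S R := by exact_mod_cast rank_pos Γ hRS
    have h2 : (rank Γ S R' : ℤ) ≤ α := Nat.cast_le.2 (rank_le Γ S R')
    have hpow : 0 < Z ^ (N - n) := pow_pos hZ _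
    have h3 : Z ^ (N - n) * (rank Γ S R' + 0) < Z ^ (N - n) * (rank Γ S R + α) :=
      mul_lt_mul_of_pos_left (by lia) hpow
    have h4 : 0 ≤ Z ^ (N - n) * ((rank Γ S R' : ℤ) + 0) := by positivity
    lia
  · exact fun hmem => hτ (Finset.mem_filter.1 hmem).2
  · exact Finset.mem_filter.2 ⟨Finset.mem_univ _, Derivable.refl _ _ _⟩

end KDep

theorem mainTheorem1 {Att Const Rel : Type*}
    [Countable Att] [Infinite Att] [Countable Const] [Infinite Const]
    [Countable Rel] [Infinite Rel] (att : Rel → Finset Att)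
    (K : Type*) [AddCommMonoid K] [Nontrivial K]
    (hpos : KDep.IsPositive K) (hwc : KDep.IsWeaklyCancellative K) :
    KDep.IsSound (att := att) KDep.Derivable (KDep.Entails Const K) ∧
      KDep.IsComplete (att := att) KDep.Derivable (KDep.Entails Const K) :=
  ⟨fun _ _ h => h.entails hpos hwc, fun _ _ h => KDep.derivable_of_entails hpos hwc h⟩
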